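/- Let $A\in\mathbb R^{d\times d}$ be symmetric and banded with half-bandwidth $m\ge 0$, i.e. $A_{i,j}=0$ whenever $|i-j|>m$. Put $\psi_1(z)=z/(e^z-1)$ (with $\psi_1(0)=1$) and, for integers $n,s\ge 0$, $$p_n(z)=1-\tfrac12 z+\sum_{i=0}^{n-1}\frac{B_{2(i+1)}}{(2(i+1))!}z^{2(i+1)},\qquad r_{n,s}(z)=2(-1)^n\Big(\frac{z}{2\pi}\Big)^{2(n+1)}\sum_{k=1}^s\frac{1}{k^{2n}\big((\frac{z}{2\pi})^2+k^2\big)},$$ $$\varepsilon_{n,s}(z)=\psi_1(z)-p_n(z)-r_{n,s}(z),$$ where $B_k$ are the Bernoulli numbers. Let $\|\cdot\|_2$ be the spectral norm, $\rho(A)$ the spectral radius, and for $k\ge1$ let $$a_k=k^2,\quad b_k=\Big(\frac{\rho(A)}{2\pi}\Big)^2+k^2,\quad r_k=\frac{b_k}{a_k},\quad \lambda_k=\Big(\frac{\sqrt{r_k}-1}{\sqrt{r_k}+1}\Big)^{1/(2m)},\quad C_k=\max\Big\{a_k^{-1},\frac{(1+\sqrt{r_k})^2}{2a_kr_k}\Big\},$$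 with $\lambda_k=0$ if $m=0$, and $0^0=1$. Then the following hold for all $i,j\in\{1,\dots,d\}$. (1) If $n\ge 1$ and $|i-j|>2mn$, then $$|[\psi_1(A)]_{i,j}|\le|[r_{n,s}(A)]_{i,j}|+|[\varepsilon_{n,s}(A)]_{i,j}|.$$ (2) For all $n,s\ge 0$, $$|[r_{n,s}(A)]_{i,j}|\le\Big\|\frac{A}{2\pi}\Big\|_2^{2(n+1)}\sum_{\nu}\sum_{k=1}^s\frac{C_k}{k^{2n}}\lambda_k^{|i-\nu|},$$ where $\nu$ runs over the indices $1\le\nu\le d$ with $j-2m(n+1)\le\nu\le j+2m(n+1)$. (3) For all $n,s\ge 0$, if $i\ne j$ (in particular if $|i-j|>2mn$), then $$|[\varepsilon_{n,s}(A)]_{i,j}|\le\Big\|\frac{A}{2\pi}\Big\|_2^{2(n+1)}\Big(\zeta(2n+2)-\sum_{k=1}^s\frac1{k^{2n+2}}\Big),$$ where $\zeta$ is the Riemann zeta function. -/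

import Mathlib

noncomputable section

namespace PhiInverse

/-- The distance `|i - j|` of two indices. -/
def idxDist {d : ℕ} (i j : Fin d) : ℕ := ((i : ℤ) - (j : ℤ)).natAbs

/-- `A` is banded with half-bandwidth `m`: `A i j = 0` whenever `|i - j| > m`. -/
def HasHalfBandwidth {d : ℕ} (A : Matrix (Fin d) (Fin d) ℝ) (m : ℕ) : Prop :=
  ∀ i j : Fin d, m < idxDist i j → A i j = 0

/-- `φ₁(x) = (e^x - 1) / x`, with its removable singularity at `0` removed. -/
def phi1 (x : ℝ) : ℝ := if x = 0 then 1 else (Real.exp x - 1) / x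

/-- `ψ₁ = 1 / φ₁`, that is `ψ₁(x) = x / (e^x - 1)`, `ψ₁(0) = 1`. -/
def psi1 (x : ℝ) : ℝ := (phi1 x)⁻¹

/-- The polynomial part
`p_n(x) = 1 - x/2 + ∑_{i=0}^{n-1} x^{2(i+1)} B_{2(i+1)} / (2(i+1))!`. -/
def polyPart (n : ℕ) (x : ℝ) : ℝ :=
  1 - x / 2 + ∑ i ∈ Finset.range n,
    x ^ (2 * (i + 1)) * ((bernoulli (2 * (i + 1)) : ℚ) : ℝ) / ((2 * (i + 1)).factorial : ℝ)

/-- The rational part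
`r_{n,s}(x) = 2 (-1)^n (x/2π)^{2(n+1)} ∑_{k=1}^s 1 / (k^{2n} ((x/2π)^2 + k^2))`. -/
def ratPart (n s : ℕ) (x : ℝ) : ℝ :=
  2 * (-1) ^ n * (x / (2 * Real.pi)) ^ (2 * (n + 1)) *
    ∑ k ∈ Finset.Icc 1 s, 1 / ((k : ℝ) ^ (2 * n) * ((x / (2 * Real.pi)) ^ 2 + (k : ℝ) ^ 2))

/-- The `(n,s)`-approximation error `ε_{n,s} = ψ₁ - p_n - r_{n,s}`. -/
def errPart (n s : ℕ) (x : ℝ) : ℝ := psi1 x - polyPart n x - ratPart n s x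

/-- The function `f(A)` of a real symmetric matrix `A`: if `A = U diag(μ) Uᵀ` is a spectral
decomposition, this is `U diag(f(μ)) Uᵀ` (see `Matrix.IsHermitian.cfc_eq`; every function is
continuous on the finite spectrum of a matrix). -/
def matFun {d : ℕ} (f : ℝ → ℝ) (A : Matrix (Fin d) (Fin d) ℝ) : Matrix (Fin d) (Fin d) ℝ :=
  cfc f A

/-- The spectral norm `‖A‖₂`: the operator norm for the Euclidean norm. -/
def norm2 {d : ℕ} (A : Matrix (Fin d) (Fin d) ℝ) : ℝ :=
  ‖Matrix.toEuclideanCLM (n := Fin d) (𝕜 := ℝ) A‖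

/-- The spectral radius `ρ(A)` as a real number (used for symmetric `A`, whose eigenvalues are
all real). -/
def rho {d : ℕ} (A : Matrix (Fin d) (Fin d) ℝ) : ℝ := (spectralRadius ℝ A).toReal

/-- `a_k = k²`. -/
def aCoef (k : ℕ) : ℝ := (k : ℝ) ^ 2

/-- `b_k = (ρ(A)/2π)² + k²`. -/
def bCoef {d : ℕ} (A : Matrix (Fin d) (Fin d) ℝ) (k : ℕ) : ℝ :=
  (rho A / (2 * Real.pi)) ^ 2 + (k : ℝ) ^ 2

/-- `r_k = b_k / a_k`. -/
def rCoef {d : ℕ} (A : Matrix (Fin d) (Fin d) ℝ) (k : ℕ) : ℝ := bCoef A k / aCoef k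

/-- `λ_k = ((√r_k - 1) / (√r_k + 1))^{1/(2m)}`. The base lies in `[0, 1)`; for `m = 0`
(a diagonal matrix), where the exponent is infinite, `λ_k = 0`. -/
def lam {d : ℕ} (A : Matrix (Fin d) (Fin d) ℝ) (m k : ℕ) : ℝ :=
  if m = 0 then 0
  else ((Real.sqrt (rCoef A k) - 1) / (Real.sqrt (rCoef A k) + 1)) ^ (1 / (2 * (m : ℝ)))

/-- `C_k = max {1/a_k, (1 + √r_k)² / (2 a_k r_k)}`. -/
def cCoef {d : ℕ} (A : Matrix (Fin d) (Fin d) ℝ) (k : ℕ) : ℝ :=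
  max (aCoef k)⁻¹ ((1 + Real.sqrt (rCoef A k)) ^ 2 / (2 * aCoef k * rCoef A k))

end PhiInverse

end

namespace PhiInverse

open Polynomial

/-! If `P` is a polynomial with `m * deg P < |i - j|`, then `P(A)` vanishes at `(i, j)`. Hence
`|f(A) i j|` is at most the uniform distance on the spectrum from `f` to such a `P`
(`HasHalfBandwidth.abs_matFun_le`). Each claim is a choice of `P`.

(1) `p_n` has degree at most `2n`, so it drops out of `ψ₁ = p_n + r_{n,s} + ε_{n,s}`.

(2) In `t = (x/2π)²`, polynomial division reduces each summand of `r_{n,s}` to a multiple of `1/(t +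
k²)`, which Chebyshev polynomials approximate geometrically (`abs_matFun_ratTerm_le_of_far`). This
handles entries far from the diagonal. Near it, the supremum of the summand over the spectrum
suffices. In both cases a single index `ν` of the sum already dominates.

(3) The Mittag-Leffler series of `ψ₁` shows that `ε_{n,s}` is the tail of the series whose first `s`
terms form `r_{n,s}` (`hasSum_errPart`). All its terms have sign `(-1)^n`, so `ε_{n,s}` ranges over
an interval with endpoint `0`. Subtracting the midpoint, a constant invisible off the diagonal,
halves the bound. -/

variable {d : ℕ} {A : Matrix (Fin d) (Fin d) ℝ}

/-! ### Entries of functions of banded symmetric matrices. -/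

/-- An entry of `f(A)` in terms of the spectral decomposition of `A`. -/
theorem matFun_apply (hA : A.IsHermitian) (f : ℝ → ℝ) (i j : Fin d) :
    matFun f A i j = ∑ l, f (hA.eigenvalues l) *
      ((hA.eigenvectorUnitary : Matrix (Fin d) (Fin d) ℝ) i l *
        (hA.eigenvectorUnitary : Matrix (Fin d) (Fin d) ℝ) j l) := by
  rw [matFun, hA.cfc_eq, Matrix.IsHermitian.cfc, Unitary.conjStarAlgAut_apply,
    Matrix.mul_apply]
  refine Finset.sum_congr rfl fun l _ => ?_
  rw [Matrix.mul_diagonal, Matrix.star_apply]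
  simp
  ring

theorem sum_sq_row_unitary (U : Matrix.unitaryGroup (Fin d) ℝ) (i : Fin d) :
    ∑ l, (U : Matrix (Fin d) (Fin d) ℝ) i l ^ 2 = 1 := by
  have h := congrFun (congrFun (Unitary.coe_mul_star_self U) i) i
  rw [Matrix.mul_apply] at h
  simpa [sq] using h

/-- In the spectral sum, `|u v| ≤ (u² + v²)/2`, and the rows of the eigenvector matrix are unit
vectors. -/
theorem abs_matFun_le_of_forall (hA : A.IsHermitian) {f : ℝ → ℝ} {ε : ℝ}
    (h : ∀ x ∈ spectrum ℝ A, |f x| ≤ ε) (i j : Fin d) : |matFun f A i j| ≤ ε := by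
  rw [matFun_apply hA]
  set U := hA.eigenvectorUnitary
  have h0 : ∀ l, |f (hA.eigenvalues l)| ≤ ε := fun l => h _ (hA.eigenvalues_mem_spectrum_real l)
  have hi := sum_sq_row_unitary U i
  have hj := sum_sq_row_unitary U j
  calc _ ≤ ∑ l, |f (hA.eigenvalues l) * ((U : Matrix (Fin d) (Fin d) ℝ) i l *
        (U : Matrix (Fin d) (Fin d) ℝ) j l)| := Finset.abs_sum_le_sum_abs _ _
    _ ≤ ∑ l, ε * (((U : Matrix (Fin d) (Fin d) ℝ) i l ^ 2 +
        (U : Matrix (Fin d) (Fin d) ℝ) j l ^ 2) / 2) := by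
      refine Finset.sum_le_sum fun l _ => ?_
      rw [abs_mul]
      refine mul_le_mul (h0 l) ?_ (abs_nonneg _) ((abs_nonneg _).trans (h0 l))
      rw [abs_le]
      constructor
      · nlinarith [sq_nonneg ((U : Matrix (Fin d) (Fin d) ℝ) i l +
          (U : Matrix (Fin d) (Fin d) ℝ) j l)]
      · nlinarith [sq_nonneg ((U : Matrix (Fin d) (Fin d) ℝ) i l -
          (U : Matrix (Fin d) (Fin d) ℝ) j l)]
    _ = ε := by
      rw [← Finset.mul_sum, ← Finset.sum_div, Finset.sum_add_distrib, hi, hj]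
      ring

theorem matFun_add (hA : A.IsHermitian) (f g : ℝ → ℝ) (i j : Fin d) :
    matFun (fun x => f x + g x) A i j = matFun f A i j + matFun g A i j := by
  simp only [matFun_apply hA, add_mul, Finset.sum_add_distrib]

theorem matFun_sum (hA : A.IsHermitian) {ι : Type*} (s : Finset ι) (f : ι → ℝ → ℝ)
    (i j : Fin d) :
    matFun (fun x => ∑ k ∈ s, f k x) A i j = ∑ k ∈ s, matFun (f k) A i j := by
  simp only [matFun_apply hA, Finset.sum_mul]
  exact Finset.sum_comm

theorem matFun_eval (hA : A.IsHermitian) (P : ℝ[X]) : matFun (fun x => P.eval x) A = aeval A P :=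
  cfc_polynomial P A hA.isSelfAdjoint

theorem HasHalfBandwidth.mul {B : Matrix (Fin d) (Fin d) ℝ} {m l : ℕ} (hA : HasHalfBandwidth A m)
    (hB : HasHalfBandwidth B l) : HasHalfBandwidth (A * B) (m + l) := by
  intro i j hij
  rw [Matrix.mul_apply]
  refine Finset.sum_eq_zero fun k _ => ?_
  by_cases hk : m < idxDist i k
  · rw [hA i k hk, zero_mul]
  · rw [hB k j (by unfold idxDist at *; omega), mul_zero]

theorem HasHalfBandwidth.pow {m : ℕ} (hA : HasHalfBandwidth A m) (k : ℕ) :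
    HasHalfBandwidth (A ^ k) (m * k) := by
  induction k with
  | zero =>
    intro i j hij
    rw [pow_zero, Matrix.one_apply_ne]
    rintro rfl
    simp [idxDist] at hij
  | succ k ih => simpa [pow_succ, mul_add] using ih.mul hA

theorem HasHalfBandwidth.aeval_apply_eq_zero {m : ℕ} (hA : HasHalfBandwidth A m) (P : ℝ[X])
    {i j : Fin d} (hij : m * P.natDegree < idxDist i j) : aeval A P i j = 0 := by
  rw [aeval_eq_sum_range, Matrix.sum_apply]
  refine Finset.sum_eq_zero fun k hk => ?_
  rw [Matrix.smul_apply, hA.pow k i j, smul_zero]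
  exact (Nat.mul_le_mul_left m (Finset.mem_range_succ_iff.mp hk)).trans_lt hij

/-- If `f` is `ε`-close on the spectrum to a polynomial of small degree, the far off-diagonal
entries of `f(A)` are at most `ε`. -/
theorem HasHalfBandwidth.abs_matFun_le {m : ℕ} (hm : HasHalfBandwidth A m) (hA : A.IsHermitian)
    {f : ℝ → ℝ} {ε : ℝ} (P : ℝ[X]) {i j : Fin d} (hij : m * P.natDegree < idxDist i j)
    (h : ∀ x ∈ spectrum ℝ A, |f x - P.eval x| ≤ ε) : |matFun f A i j| ≤ ε := by
  have h1 : matFun f A i j = matFun (fun x => f x - P.eval x) A i j := by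
    have := matFun_add hA (fun x => f x - P.eval x) (fun x => P.eval x) i j
    simpa [matFun_eval hA, hm.aeval_apply_eq_zero P hij] using this
  rw [h1]
  exact abs_matFun_le_of_forall hA h i j

/-! ### Spectrum, spectral radius and spectral norm. -/

theorem abs_le_rho {x : ℝ} (hx : x ∈ spectrum ℝ A) : |x| ≤ rho A := by
  have h : (‖x‖₊ : ENNReal) ≤ spectralRadius ℝ A :=
    le_iSup₂ (f := fun (k : ℝ) (_ : k ∈ spectrum ℝ A) => (‖k‖₊ : ENNReal)) x hx
  have hfin : spectralRadius ℝ A ≠ ⊤ := by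
    obtain ⟨M, hM⟩ := (Matrix.finite_real_spectrum (A := A)).image (fun x => ‖x‖₊) |>.bddAbove
    refine ne_top_of_le_ne_top (ENNReal.coe_ne_top (r := M)) (iSup₂_le fun k hk => ?_)
    exact_mod_cast hM ⟨k, hk, rfl⟩
  have := ENNReal.toReal_mono hfin h
  simpa [rho] using this

theorem rho_nonneg : 0 ≤ rho A := ENNReal.toReal_nonneg

theorem abs_le_norm2 {x : ℝ} (hx : x ∈ spectrum ℝ A) : |x| ≤ norm2 A := by
  rcases isEmpty_or_nonempty (Fin d) with h | h
  · exact absurd hx (by simp [spectrum.of_subsingleton])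
  have : x ∈ spectrum ℝ (Matrix.toEuclideanCLM (n := Fin d) (𝕜 := ℝ) A) := by
    rwa [AlgEquiv.spectrum_eq (Matrix.toEuclideanCLM (n := Fin d) (𝕜 := ℝ))]
  exact spectrum.norm_le_norm_of_mem this

theorem norm2_smul (c : ℝ) : norm2 (c • A) = |c| * norm2 A := by
  rw [norm2, map_smul, norm_smul, norm2, Real.norm_eq_abs]

theorem rho_le_norm2 : rho A ≤ norm2 A := by
  refine ENNReal.toReal_le_of_le_ofReal (norm_nonneg _) (iSup₂_le fun k hk => ?_)
  exact (ofReal_norm k).symm.trans_le (ENNReal.ofReal_le_ofReal (abs_le_norm2 hk))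

theorem rho_div_le_norm2 : rho A / (2 * Real.pi) ≤ norm2 ((1 / (2 * Real.pi)) • A) := by
  rw [norm2_smul, abs_of_pos (by positivity), one_div_mul_eq_div]
  gcongr
  exact rho_le_norm2

/-! ### Polynomial approximation of the rational summands. -/

/-- Chebyshev approximation of `1 / (t + a)` on `[0, w]`. -/
theorem exists_natDegree_le_abs_inv_sub_eval_le {a w : ℝ} (ha : 0 < a) (hw : 0 < w) (D : ℕ) :
    ∃ p : ℝ[X], p.natDegree ≤ D ∧ ∀ t ∈ Set.Icc 0 w, |1 / (t + a) - p.eval t| ≤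
      2 * ((√((w + a) / a) - 1) / (√((w + a) / a) + 1)) ^ (D + 1) / a := by
  set σ := √((w + a) / a) with hσ
  have hσ2 : σ ^ 2 = (w + a) / a := Real.sq_sqrt (by positivity)
  have hσ1 : 1 < σ := by
    rw [hσ, Real.lt_sqrt (by norm_num), one_pow, lt_div_iff₀ ha]
    linarith
  set q := (σ - 1) / (σ + 1) with hq
  have hq0 : 0 < q := div_pos (by linarith) (by linarith)
  have hw' : w = a * (σ ^ 2 - 1) := by rw [hσ2]; field_simp; ring
  -- `-(2a + w)/w` is the image of the pole `-a` under the affine map `ℓ` from `[0, w]` to `[-1,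
  -- 1]`. Writing its modulus as `cosh (log q)` makes the Chebyshev value there explicit.
  have hcosh : Real.cosh (Real.log q) = (2 * a + w) / w := by
    rw [Real.cosh_log hq0, hw', hq]
    have h1 : σ - 1 ≠ 0 := by linarith
    have h2 : σ + 1 ≠ 0 := by linarith
    have h3 : σ ^ 2 - 1 ≠ 0 := by nlinarith
    field_simp
    ring
  set T := Chebyshev.T ℝ ((D + 1 : ℕ) : ℤ) with hT
  set τ := T.eval (-((2 * a + w) / w)) with hτ
  have hτabs : 1 / |τ| ≤ 2 * q ^ (D + 1) := by
    have h1 : |τ| = Real.cosh (((D + 1 : ℕ) : ℝ) * Real.log q) := by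
      rw [hτ, hT, Chebyshev.T_eval_neg, abs_mul, ← hcosh, Chebyshev.T_real_cosh]
      rw [Int.cast_natCast, abs_of_pos (Real.cosh_pos _)]
      simp
    have h2 : Real.cosh (((D + 1 : ℕ) : ℝ) * Real.log q) =
        (q ^ (D + 1) + (q ^ (D + 1))⁻¹) / 2 := by
      rw [← Real.log_pow, Real.cosh_log (by positivity)]
    rw [h1, h2, div_le_iff₀ (by positivity)]
    have h3 : q ^ (D + 1) * (q ^ (D + 1))⁻¹ = 1 := mul_inv_cancel₀ (by positivity)
    nlinarith [sq_nonneg (q ^ (D + 1))]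
  have hτ0 : τ ≠ 0 := by
    have := Chebyshev.one_le_abs_eval_T_real ((D + 1 : ℕ) : ℤ) (x := -((2 * a + w) / w))
      (by rw [abs_neg, abs_of_pos (by positivity), le_div_iff₀ hw]; linarith)
    intro h
    rw [← hT, ← hτ, h] at this
    norm_num at this
  set ℓ : ℝ[X] := C (2 / w) * X + C (-1) with hℓ
  have hℓdeg : ℓ.natDegree = 1 := natDegree_linear (by positivity)
  -- Normalised so that `Q(-a) = 1`: then `t + a` divides `1 - Q`, and the quotient misses `1/(t +
  -- a)` by exactly `Q/(t + a)`.
  set Q : ℝ[X] := C τ⁻¹ * T.comp ℓ with hQ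
  have hQdeg : Q.natDegree ≤ D + 1 := by
    refine (natDegree_C_mul_le _ _).trans ?_
    rw [natDegree_comp, hℓdeg, hT, Chebyshev.natDegree_T, Int.natAbs_natCast, mul_one]
  have hroot : (1 - Q).IsRoot (-a) := by
    have : ℓ.eval (-a) = -((2 * a + w) / w) := by
      simp only [hℓ, eval_add, eval_mul, eval_C, eval_X]
      field_simp
      ring
    rw [IsRoot, eval_sub, eval_one, hQ, eval_mul, eval_C, eval_comp, this, ← hτ,
      inv_mul_cancel₀ hτ0, sub_self]
  refine ⟨(1 - Q) /ₘ (X - C (-a)), ?_, fun t ht => ?_⟩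
  · rw [natDegree_divByMonic _ (monic_X_sub_C _), natDegree_X_sub_C]
    have := natDegree_sub_le (1 : ℝ[X]) Q
    rw [natDegree_one] at this
    omega
  · have hta : 0 < t + a := by linarith [ht.1]
    have h1 := congrArg (eval t) (mul_divByMonic_eq_iff_isRoot.mpr hroot)
    rw [eval_mul, eval_sub, eval_X, eval_C, eval_sub, eval_one] at h1
    have h2 : 1 / (t + a) - ((1 - Q) /ₘ (X - C (-a))).eval t = Q.eval t / (t + a) := by
      field_simp
      linarith
    have h3 : |Q.eval t| ≤ 2 * q ^ (D + 1) := by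
      rw [hQ, eval_mul, eval_C, eval_comp, abs_mul, abs_inv]
      have : |T.eval (ℓ.eval t)| ≤ 1 := by
        refine Chebyshev.abs_eval_T_real_le_one _ ?_
        simp only [hℓ, eval_add, eval_mul, eval_C, eval_X]
        have h4 : 2 / w * t ≤ 2 := by
          rw [div_mul_eq_mul_div, div_le_iff₀ hw]; linarith [ht.2]
        have h5 : 0 ≤ 2 / w * t := mul_nonneg (by positivity) ht.1
        rw [abs_le]
        constructor <;> linarith
      calc _ ≤ |τ|⁻¹ * 1 := by gcongr
        _ ≤ _ := by rw [mul_one, ← one_div]; exact hτabs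
    rw [h2, abs_div, abs_of_pos hta]
    gcongr
    linarith [ht.1]

theorem pow_div_add_eq (n : ℕ) (a : ℝ) : ∃ p : ℝ[X], p.natDegree ≤ n ∧
    ∀ t, t + a ≠ 0 → t ^ (n + 1) / (t + a) = p.eval t + (-a) ^ (n + 1) / (t + a) := by
  have hroot : (X ^ (n + 1) - C ((-a) ^ (n + 1))).IsRoot (-a) := by
    simp [IsRoot]
  refine ⟨(X ^ (n + 1) - C ((-a) ^ (n + 1))) /ₘ (X - C (-a)), ?_, fun t ht => ?_⟩
  · rw [natDegree_divByMonic _ (monic_X_sub_C _), natDegree_X_sub_C, natDegree_X_pow_sub_C]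
    simp
  · have h1 := congrArg (eval t) (mul_divByMonic_eq_iff_isRoot.mpr hroot)
    rw [eval_mul, eval_sub, eval_X, eval_C, eval_sub, eval_pow, eval_X, eval_C] at h1
    field_simp
    linarith

/-- With bandwidth `0` the degree is unrestricted, so `f` can be interpolated exactly on the finite
spectrum. -/
theorem HasHalfBandwidth.matFun_eq_zero (hm : HasHalfBandwidth A 0) (hA : A.IsHermitian)
    (f : ℝ → ℝ) {i j : Fin d} (hij : 0 < idxDist i j) : matFun f A i j = 0 := by
  refine abs_nonpos_iff.mp (hm.abs_matFun_le hA
    (Lagrange.interpolate (Matrix.finite_real_spectrum (A := A)).toFinset id f) (by simpa)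
    fun x hx => ?_)
  have := Lagrange.eval_interpolate_at_node f (v := id) (i := x)
    (s := (Matrix.finite_real_spectrum (A := A)).toFinset) (Set.injOn_id _) (by simpa using hx)
  rw [id] at this
  rw [this, sub_self, abs_zero]

/-! ### Bounds for the rational part. -/

/-- The `k`-th summand of `ratPart`. -/
noncomputable def ratTerm (n k : ℕ) (x : ℝ) : ℝ :=
  2 * (-1) ^ n * (x / (2 * Real.pi)) ^ (2 * (n + 1)) *
    (1 / ((k : ℝ) ^ (2 * n) * ((x / (2 * Real.pi)) ^ 2 + (k : ℝ) ^ 2)))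

theorem ratPart_eq_sum (n s : ℕ) : ratPart n s = fun x => ∑ k ∈ Finset.Icc 1 s, ratTerm n k x := by
  ext x
  rw [ratPart, Finset.mul_sum]
  rfl

theorem ratTerm_eq (n k : ℕ) (x : ℝ) : ratTerm n k x = 2 * (-1) ^ n / (k : ℝ) ^ (2 * n) *
    (((x / (2 * Real.pi)) ^ 2) ^ (n + 1) / ((x / (2 * Real.pi)) ^ 2 + (k : ℝ) ^ 2)) := by
  rw [ratTerm, ← pow_mul, mul_one_div, mul_comm ((k : ℝ) ^ (2 * n)), ← div_div]
  ring

theorem abs_ratTerm (n k : ℕ) (x : ℝ) : |ratTerm n k x| = 2 / (k : ℝ) ^ (2 * n) *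
    (((x / (2 * Real.pi)) ^ 2) ^ (n + 1) / ((x / (2 * Real.pi)) ^ 2 + (k : ℝ) ^ 2)) := by
  rw [ratTerm_eq, abs_mul, abs_div, abs_mul, abs_pow, abs_neg, abs_one, one_pow, mul_one,
    abs_of_nonneg (a := (_ : ℝ) / (_ + _)) (by positivity), abs_two,
    abs_of_nonneg (a := (k : ℝ) ^ (2 * n)) (by positivity)]

theorem sq_div_le_of_mem_spectrum {x : ℝ} (hx : x ∈ spectrum ℝ A) :
    (x / (2 * Real.pi)) ^ 2 ≤ (rho A / (2 * Real.pi)) ^ 2 := by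
  rw [← sq_abs, abs_div, abs_of_pos (a := 2 * Real.pi) (by positivity)]
  have := abs_le_rho hx
  gcongr

theorem pow_div_add_le {t w a : ℝ} (n : ℕ) (ht : 0 ≤ t) (htw : t ≤ w) (ha : 0 < a) :
    t ^ (n + 1) / (t + a) ≤ w ^ (n + 1) / (w + a) := by
  have hw : 0 ≤ w := ht.trans htw
  rw [pow_succ, mul_div_assoc, pow_succ, mul_div_assoc]
  have : t / (t + a) ≤ w / (w + a) := by
    rw [div_le_div_iff₀ (by positivity) (by positivity)]
    nlinarith
  gcongr

theorem rCoef_eq (A : Matrix (Fin d) (Fin d) ℝ) (k : ℕ) :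
    rCoef A k = ((rho A / (2 * Real.pi)) ^ 2 + (k : ℝ) ^ 2) / (k : ℝ) ^ 2 := rfl

theorem one_le_sqrt_rCoef {k : ℕ} (hk : 1 ≤ k) : 1 ≤ √(rCoef A k) := by
  have : (0 : ℝ) < k := by exact_mod_cast hk
  rw [Real.one_le_sqrt, rCoef_eq, le_div_iff₀ (by positivity)]
  nlinarith [sq_nonneg (rho A / (2 * Real.pi))]

theorem inv_sq_le_cCoef (k : ℕ) : ((k : ℝ) ^ 2)⁻¹ ≤ cCoef A k := le_max_left _ _

theorem cCoef_nonneg (k : ℕ) : 0 ≤ cCoef A k :=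
  le_trans (by positivity) (inv_sq_le_cCoef (A := A) k)

theorem two_div_le_cCoef {k : ℕ} (hk : 1 ≤ k) :
    2 / ((rho A / (2 * Real.pi)) ^ 2 + (k : ℝ) ^ 2) ≤ cCoef A k := by
  have hk0 : (0 : ℝ) < k := by exact_mod_cast hk
  refine le_trans ?_ (le_max_right _ _)
  have h : 2 * aCoef k * rCoef A k = 2 * ((rho A / (2 * Real.pi)) ^ 2 + (k : ℝ) ^ 2) := by
    rw [rCoef_eq, aCoef]
    field_simp
  rw [h, div_le_div_iff₀ (by positivity) (by positivity)]
  have h1 : 4 ≤ (1 + √(rCoef A k)) ^ 2 := by nlinarith [one_le_sqrt_rCoef (A := A) hk]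
  have h2 : 0 ≤ (rho A / (2 * Real.pi)) ^ 2 + (k : ℝ) ^ 2 := by positivity
  nlinarith

/-- The convergence factor `(√r_k - 1) / (√r_k + 1)`. -/
noncomputable def chebRate (A : Matrix (Fin d) (Fin d) ℝ) (k : ℕ) : ℝ :=
  (√(rCoef A k) - 1) / (√(rCoef A k) + 1)

theorem chebRate_nonneg {k : ℕ} (hk : 1 ≤ k) : 0 ≤ chebRate A k :=
  div_nonneg (by linarith [one_le_sqrt_rCoef (A := A) hk]) (by positivity)

theorem chebRate_le_one (k : ℕ) : chebRate A k ≤ 1 := by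
  rw [chebRate, div_le_one (by positivity)]
  linarith

/-- With `σ = √r_k` and `Y = ρ(A)/2π`, `Y² = k²(σ² - 1)`, so the left side equals `Y²/(σ + 1)²`, and
`σ ≥ 1`. This trades powers of the rate for the prefactor `Y^(2(n+1))`. -/
theorem sq_mul_chebRate_le {k : ℕ} (hk : 1 ≤ k) :
    (k : ℝ) ^ 2 * chebRate A k ≤ (rho A / (2 * Real.pi)) ^ 2 / 4 := by
  have hk0 : (0 : ℝ) < k := by exact_mod_cast hk
  have hσ := one_le_sqrt_rCoef (A := A) hk
  have hσ2 : √(rCoef A k) ^ 2 = rCoef A k := Real.sq_sqrt (by rw [rCoef_eq]; positivity)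
  have h : (rho A / (2 * Real.pi)) ^ 2 = (k : ℝ) ^ 2 * (√(rCoef A k) ^ 2 - 1) := by
    rw [hσ2, rCoef_eq]
    field_simp
    ring
  rw [h, chebRate, mul_div_assoc ((k : ℝ) ^ 2) (_ - 1) 4]
  refine mul_le_mul_of_nonneg_left ?_ (by positivity)
  rw [div_le_div_iff₀ (by positivity) (by norm_num)]
  nlinarith [mul_nonneg (sub_nonneg.mpr hσ) (mul_nonneg (sub_nonneg.mpr hσ) (by positivity :
    0 ≤ √(rCoef A k) + 3))]

theorem lam_nonneg {m k : ℕ} (hk : 1 ≤ k) : 0 ≤ lam A m k := by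
  rw [lam]
  split_ifs
  · exact le_rfl
  · exact Real.rpow_nonneg (chebRate_nonneg hk) _

theorem chebRate_pow_le_lam_pow {m k D l : ℕ} (hk : 1 ≤ k) (hm : m ≠ 0) (h : l ≤ 2 * m * D) :
    chebRate A k ^ D ≤ lam A m k ^ l := by
  have hq := chebRate_nonneg (A := A) hk
  have hl : lam A m k = chebRate A k ^ (1 / (2 * (m : ℝ))) := by rw [lam, if_neg hm, chebRate]
  have hl1 : lam A m k ≤ 1 := by
    rw [hl]
    exact Real.rpow_le_one hq (chebRate_le_one k) (by positivity)
  have hl2 : lam A m k ^ (2 * m) = chebRate A k := by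
    rw [hl, ← Real.rpow_natCast, ← Real.rpow_mul hq]
    push_cast
    rw [one_div_mul_cancel (by positivity), Real.rpow_one]
  calc chebRate A k ^ D = lam A m k ^ (2 * m * D) := by rw [pow_mul, hl2]
    _ ≤ _ := pow_le_pow_of_le_one (lam_nonneg hk) hl1 h

theorem exists_idxDist_eq {i j : Fin d} {l : ℕ} (h : l ≤ idxDist i j) :
    ∃ ν : Fin d, idxDist i ν = idxDist i j - l ∧ idxDist ν j = l := by
  unfold idxDist at *
  rcases le_total i j with hij | hij
  · have : (i : ℕ) ≤ j := hij
    exact ⟨⟨j - l, by omega⟩, by simp only []; omega, by simp only []; omega⟩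
  · have : (j : ℕ) ≤ i := hij
    exact ⟨⟨j + l, by omega⟩, by simp only []; omega, by simp only []; omega⟩

theorem abs_matFun_ratTerm_le_of_far {m : ℕ} (hm : HasHalfBandwidth A m) (hA : A.IsHermitian)
    (hm0 : m ≠ 0) {n k : ℕ} (hk : 1 ≤ k) {i j : Fin d} (hij : 2 * m * (n + 1) < idxDist i j) :
    |matFun (ratTerm n k) A i j| ≤ (rho A / (2 * Real.pi)) ^ (2 * (n + 1)) *
      (cCoef A k / (k : ℝ) ^ (2 * n) * lam A m k ^ (idxDist i j - 2 * m * (n + 1))) := by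
  have hk0 : (0 : ℝ) < k := by exact_mod_cast hk
  set Y := rho A / (2 * Real.pi) with hY
  have hY0 : 0 ≤ Y := div_nonneg rho_nonneg (by positivity)
  have hrhs : 0 ≤ Y ^ (2 * (n + 1)) *
      (cCoef A k / (k : ℝ) ^ (2 * n) * lam A m k ^ (idxDist i j - 2 * m * (n + 1))) := by
    have := cCoef_nonneg (A := A) k
    have := lam_nonneg (A := A) (m := m) hk
    positivity
  -- The Chebyshev bound needs an interval of positive length. If `ρ(A) = 0`, the summand vanishes
  -- on the spectrum.
  rcases hY0.eq_or_lt with h0 | hpos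
  · refine (abs_matFun_le_of_forall hA (ε := 0) (fun x hx => ?_) i j).trans hrhs
    have h1 := sq_div_le_of_mem_spectrum hx
    rw [← hY, ← h0] at h1
    have h2 : (x / (2 * Real.pi)) ^ 2 = 0 := le_antisymm (by simpa using h1) (sq_nonneg _)
    rw [abs_ratTerm, h2]
    simp
  -- `D` is the largest degree in `t`, that is `2D` in `x`, whose polynomials in `A` still vanish at
  -- `(i, j)`.
  obtain ⟨D, hD1, hD2⟩ : ∃ D, 2 * m * D < idxDist i j ∧ idxDist i j ≤ 2 * m * (D + 1) := by
    have hm2 : 0 < 2 * m := by omega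
    refine ⟨(idxDist i j - 1) / (2 * m), ?_, ?_⟩
    · have := Nat.mul_div_le (idxDist i j - 1) (2 * m)
      omega
    · have := Nat.lt_mul_div_succ (idxDist i j - 1) hm2
      omega
  have hnD : n + 1 ≤ D := by
    have := Nat.lt_of_mul_lt_mul_left (hij.trans_le hD2)
    omega
  obtain ⟨p, hp, hpe⟩ := exists_natDegree_le_abs_inv_sub_eval_le (a := (k : ℝ) ^ 2) (w := Y ^ 2)
    (by positivity) (by positivity) D
  obtain ⟨p', hp', hpe'⟩ := pow_div_add_eq n ((k : ℝ) ^ 2)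
  set c : ℝ := 2 * (-1) ^ n / (k : ℝ) ^ (2 * n) with hc
  set R : ℝ[X] := p' + C ((-(k : ℝ) ^ 2) ^ (n + 1)) * p with hR
  have hRdeg : R.natDegree ≤ D := by
    refine natDegree_add_le_of_degree_le (by omega) ((natDegree_C_mul_le _ _).trans hp)
  set P : ℝ[X] := C c * R.comp (C ((1 / (2 * Real.pi)) ^ 2) * X ^ 2) with hP
  have hPdeg : P.natDegree ≤ 2 * D := by
    refine (natDegree_C_mul_le _ _).trans (natDegree_comp_le.trans ?_)
    rw [mul_comm]
    exact Nat.mul_le_mul (natDegree_C_mul_X_pow_le _ _) hRdeg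
  refine hm.abs_matFun_le hA P ?_ fun x hx => ?_
  · calc m * P.natDegree ≤ m * (2 * D) := Nat.mul_le_mul_left m hPdeg
      _ = 2 * m * D := by ring
      _ < _ := hD1
  set t := (x / (2 * Real.pi)) ^ 2 with ht
  have ht0 : 0 ≤ t := sq_nonneg _
  have htY : t ≤ Y ^ 2 := sq_div_le_of_mem_spectrum hx
  have hta : t + (k : ℝ) ^ 2 ≠ 0 := by positivity
  have hPx : P.eval x = c * (p'.eval t + (-(k : ℝ) ^ 2) ^ (n + 1) * p.eval t) := by
    have : (1 / (2 * Real.pi)) ^ 2 * x ^ 2 = t := by rw [ht, ← mul_pow]; ring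
    simp only [hP, hR, eval_mul, eval_C, eval_comp, eval_add, eval_pow, eval_X, this]
  have hdiff : ratTerm n k x - P.eval x =
      c * (-(k : ℝ) ^ 2) ^ (n + 1) * (1 / (t + (k : ℝ) ^ 2) - p.eval t) := by
    rw [hPx, ratTerm_eq, ← ht, hpe' t hta, ← hc]
    ring
  have hcabs : |c * (-(k : ℝ) ^ 2) ^ (n + 1)| = 2 * (k : ℝ) ^ 2 := by
    simp only [hc, abs_mul, abs_div, abs_pow, abs_neg, abs_one, one_pow, mul_one, abs_two,
      Nat.abs_cast, ← pow_mul]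
    field_simp
    ring
  have hq0 := chebRate_nonneg (A := A) hk
  have herr := hpe t ⟨ht0, htY⟩
  rw [hY, ← rCoef_eq, ← chebRate] at herr
  -- The error `q^(D+1)` is split as `q^(n+1) * q^(D-n)`: the first factor yields the power of `Y`,
  -- the second the decay in `λ_k`.
  have hqn : chebRate A k ^ (n + 1) ≤ Y ^ (2 * (n + 1)) / (4 * (k : ℝ) ^ (2 * (n + 1))) := by
    have h1 := pow_le_pow_left₀ (by positivity) (sq_mul_chebRate_le (A := A) hk) (n + 1)
    rw [mul_pow, div_pow, ← pow_mul, ← pow_mul, ← hY] at h1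
    rw [le_div_iff₀ (by positivity)]
    have h4 : (4 : ℝ) ≤ 4 ^ (n + 1) := le_self_pow₀ (by norm_num) (by omega)
    have h5 : Y ^ (2 * (n + 1)) / 4 ^ (n + 1) ≤ Y ^ (2 * (n + 1)) / 4 := by gcongr
    linarith
  have hlam := chebRate_pow_le_lam_pow (A := A) (m := m) (D := D - n)
    (l := idxDist i j - 2 * m * (n + 1)) hk hm0 (by
      obtain ⟨e, rfl⟩ := Nat.exists_eq_add_of_le hnD
      have h1 : 2 * m * (n + 1 + e + 1) = 2 * m * (n + 1) + 2 * m * (n + 1 + e - n) := by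
        rw [← mul_add]; congr 1; omega
      omega)
  rw [hdiff, abs_mul, hcabs]
  calc 2 * (k : ℝ) ^ 2 * |1 / (t + (k : ℝ) ^ 2) - p.eval t|
      ≤ 2 * (k : ℝ) ^ 2 * (2 * chebRate A k ^ (D + 1) / (k : ℝ) ^ 2) := by gcongr
    _ = 4 * (chebRate A k ^ (n + 1) * chebRate A k ^ (D - n)) := by
      rw [← pow_add, show n + 1 + (D - n) = D + 1 by omega]
      field_simp
      ring
    _ ≤ 4 * (Y ^ (2 * (n + 1)) / (4 * (k : ℝ) ^ (2 * (n + 1))) *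
        lam A m k ^ (idxDist i j - 2 * m * (n + 1))) := by gcongr
    _ = Y ^ (2 * (n + 1)) * (((k : ℝ) ^ 2)⁻¹ / (k : ℝ) ^ (2 * n) *
        lam A m k ^ (idxDist i j - 2 * m * (n + 1))) := by
      rw [mul_add, pow_add]
      field_simp
      ring
    _ ≤ _ := by
      have := inv_sq_le_cCoef (A := A) k
      have := lam_nonneg (A := A) (m := m) hk
      gcongr

theorem abs_matFun_ratTerm_le (hA : A.IsHermitian) (n : ℕ) {k : ℕ} (hk : 1 ≤ k) (i j : Fin d) :
    |matFun (ratTerm n k) A i j| ≤ (rho A / (2 * Real.pi)) ^ (2 * (n + 1)) *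
      (cCoef A k / (k : ℝ) ^ (2 * n)) := by
  have hk0 : (0 : ℝ) < k := by exact_mod_cast hk
  refine abs_matFun_le_of_forall hA (fun x hx => ?_) i j
  rw [abs_ratTerm]
  calc _ ≤ 2 / (k : ℝ) ^ (2 * n) * (((rho A / (2 * Real.pi)) ^ 2) ^ (n + 1) /
        ((rho A / (2 * Real.pi)) ^ 2 + (k : ℝ) ^ 2)) := by
        gcongr ?_ * ?_
        exact pow_div_add_le n (sq_nonneg _) (sq_div_le_of_mem_spectrum hx) (by positivity)
    _ = (rho A / (2 * Real.pi)) ^ (2 * (n + 1)) *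
        ((2 / ((rho A / (2 * Real.pi)) ^ 2 + (k : ℝ) ^ 2)) / (k : ℝ) ^ (2 * n)) := by
        rw [← pow_mul]
        ring
    _ ≤ _ := by
        have := two_div_le_cCoef (A := A) hk
        have : 0 ≤ (rho A / (2 * Real.pi)) ^ (2 * (n + 1)) := by
          rw [pow_mul]; positivity
        gcongr

theorem abs_matFun_ratPart_le {m : ℕ} (hm : HasHalfBandwidth A m) (hA : A.IsHermitian)
    (n s : ℕ) (i j : Fin d) :
    |matFun (ratPart n s) A i j| ≤ norm2 ((1 / (2 * Real.pi)) • A) ^ (2 * (n + 1)) *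
      ∑ ν : Fin d with idxDist ν j ≤ 2 * m * (n + 1), ∑ k ∈ Finset.Icc 1 s,
        cCoef A k / (k : ℝ) ^ (2 * n) * lam A m k ^ idxDist i ν := by
  have hY0 : 0 ≤ rho A / (2 * Real.pi) := div_nonneg rho_nonneg (by positivity)
  rw [ratPart_eq_sum, matFun_sum hA, Finset.sum_comm, Finset.mul_sum]
  refine (Finset.abs_sum_le_sum_abs _ _).trans (Finset.sum_le_sum fun k hk => ?_)
  have hk1 : 1 ≤ k := (Finset.mem_Icc.mp hk).1
  have hC := cCoef_nonneg (A := A) k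
  have hl := lam_nonneg (A := A) (m := m) hk1
  have hN : 0 ≤ norm2 ((1 / (2 * Real.pi)) • A) := norm_nonneg _
  have hterm : ∀ ν : Fin d, 0 ≤ cCoef A k / (k : ℝ) ^ (2 * n) * lam A m k ^ idxDist i ν :=
    fun ν => by positivity
  -- it suffices to bound the entry by a single summand of the sum over `ν`
  have key : ∀ ν : Fin d, idxDist ν j ≤ 2 * m * (n + 1) →
      |matFun (ratTerm n k) A i j| ≤ (rho A / (2 * Real.pi)) ^ (2 * (n + 1)) *
        (cCoef A k / (k : ℝ) ^ (2 * n) * lam A m k ^ idxDist i ν) →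
      |matFun (ratTerm n k) A i j| ≤ norm2 ((1 / (2 * Real.pi)) • A) ^ (2 * (n + 1)) *
        ∑ ν : Fin d with idxDist ν j ≤ 2 * m * (n + 1),
          cCoef A k / (k : ℝ) ^ (2 * n) * lam A m k ^ idxDist i ν := by
    intro ν hν h
    refine h.trans (mul_le_mul (pow_le_pow_left₀ hY0 rho_div_le_norm2 _) ?_ (hterm ν)
      (by positivity))
    exact Finset.single_le_sum
      (f := fun ν => cCoef A k / (k : ℝ) ^ (2 * n) * lam A m k ^ idxDist i ν)
      (fun ν _ => hterm ν) (by simpa using hν)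
  rcases le_or_gt (idxDist i j) (2 * m * (n + 1)) with hij | hij
  -- Here `ν = i` is admissible and its factor is `λ_k^0 = 1`.
  · refine key i hij ?_
    have : idxDist i i = 0 := by simp [idxDist]
    rw [this, pow_zero, mul_one]
    exact abs_matFun_ratTerm_le hA n hk1 i j
  -- `ν` lies between `i` and `j` on the edge of the window around `j`, so `|i - ν| = |i - j| -
  -- 2m(n+1)`.
  · obtain ⟨ν, hν1, hν2⟩ := exists_idxDist_eq hij.le
    rcases eq_or_ne m 0 with rfl | hm0
    · rw [hm.matFun_eq_zero hA _ (by omega), abs_zero]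
      exact mul_nonneg (by positivity) (Finset.sum_nonneg fun ν _ => hterm ν)
    · refine key ν hν2.le ?_
      rw [hν1]
      exact abs_matFun_ratTerm_le_of_far hm hA hm0 hk1 hij

/-! ### Series expansions of `ψ₁` and of the error. -/

theorem psi1_of_ne_zero {x : ℝ} (hx : x ≠ 0) : psi1 x = x / (Real.exp x - 1) := by
  rw [psi1, phi1, if_neg hx, inv_div]

/-- Mittag-Leffler expansion of `x / (e^x - 1)`. -/
theorem hasSum_psi1 (x : ℝ) :
    HasSum (fun j : ℕ => 2 * ((x / (2 * Real.pi)) ^ 2 /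
      ((x / (2 * Real.pi)) ^ 2 + ((j + 1 : ℕ) : ℝ) ^ 2))) (psi1 x - 1 + x / 2) := by
  rcases eq_or_ne x 0 with rfl | hx
  · simp [psi1, phi1, hasSum_zero]
  set y := x / (2 * Real.pi) with hy
  have hxy : x = 2 * Real.pi * y := by rw [hy]; field_simp
  have hy0 : y ≠ 0 := by rintro h; simp [hxy, h] at hx
  have hyC : (y : ℂ) ≠ 0 := by exact_mod_cast hy0
  -- On the imaginary axis `π z cot(π z) = (x/2) coth(x/2) = ψ₁(x) + x/2`, so the partial fractions
  -- of the cotangent give the series.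
  set z : ℂ := Complex.I * y with hz
  have hz0 : z ≠ 0 := mul_ne_zero Complex.I_ne_zero hyC
  have hzmem : z ∈ Complex.integerComplement := by
    rintro ⟨l, hl⟩
    have := congrArg Complex.im hl
    simp [hz] at this
    exact hy0 this.symm
  have hsum := (summable_cotTerm hzmem).hasSum
  rw [show ∑' n, cotTerm z n = _ from (cot_series_rep' hzmem).symm] at hsum
  have hsum := hsum.mul_left z
  have hexp1 : Real.exp x - 1 ≠ 0 := by
    rw [sub_ne_zero]; exact fun h => hx (Real.exp_eq_one_iff x |>.mp h)
  have hexp1C : (Complex.exp x - 1) ≠ 0 := by exact_mod_cast hexp1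
  have hval : z * (Real.pi * Complex.cot (Real.pi * z) - 1 / z) =
      ((psi1 x - 1 + x / 2 : ℝ) : ℂ) := by
    have he : Complex.exp (2 * Real.pi * Complex.I * z) = (Complex.exp x)⁻¹ := by
      rw [← Complex.exp_neg, hz, hxy]
      congr 1
      push_cast
      linear_combination (2 * Real.pi * y : ℂ) * Complex.I_mul_I
    rw [Complex.cot_pi_eq_exp_ratio, he, psi1_of_ne_zero hx]
    have hE := Complex.exp_ne_zero x
    have h1 : (1 - (Complex.exp x)⁻¹) ≠ 0 := by
      rw [sub_ne_zero]
      intro h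
      exact hexp1C (by rw [← inv_inv (Complex.exp x), ← h]; simp)
    have h2 : ((Complex.exp x)⁻¹ + 1) / (Complex.I * (1 - (Complex.exp x)⁻¹)) =
        (Complex.exp x + 1) / (Complex.I * (Complex.exp x - 1)) := by
      have hI := Complex.I_ne_zero
      rw [div_eq_div_iff (mul_ne_zero hI h1) (mul_ne_zero hI hexp1C)]
      field_simp
      ring
    rw [h2, mul_sub, mul_one_div_cancel hz0, hz]
    push_cast
    have hxC : (x : ℂ) = 2 * Real.pi * y := by exact_mod_cast hxy
    have hI := Complex.I_ne_zero
    field_simp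
    rw [hxC]
    ring
  rw [hval] at hsum
  have hterm : ∀ j : ℕ, z * cotTerm z j =
      ((2 * (y ^ 2 / (y ^ 2 + ((j + 1 : ℕ) : ℝ) ^ 2)) : ℝ) : ℂ) := by
    intro j
    rw [cotTerm_identity hzmem, show (z + (j + 1)) * (z - (j + 1)) = z * z - (j + 1) ^ 2 by ring]
    have hzz : z * z = -(y : ℂ) ^ 2 := by
      rw [hz]; linear_combination (y : ℂ) ^ 2 * Complex.I_mul_I
    have hne : (y : ℂ) ^ 2 + (j + 1) ^ 2 ≠ 0 := by
      have : y ^ 2 + ((j : ℝ) + 1) ^ 2 ≠ 0 := by positivity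
      exact_mod_cast this
    have hne' : -(y : ℂ) ^ 2 - (j + 1) ^ 2 ≠ 0 := by
      rw [← neg_add']; exact neg_ne_zero.mpr hne
    rw [show z * (2 * z * (1 / (z * z - (j + 1) ^ 2))) =
      2 * (z * z) * (1 / (z * z - (j + 1) ^ 2)) by ring, hzz]
    push_cast
    field_simp
    ring
  rw [funext hterm] at hsum
  exact Complex.hasSum_ofReal.mp hsum

/-- Finite geometric expansion in `-t/K`. With `K = k²` summed over `k`, the powers give the values
`ζ(2i+2)`, hence the Bernoulli terms of `p_n`, and the remainder gives `ratTerm`. -/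
theorem div_add_eq_sum {t K : ℝ} (hK : K ≠ 0) (htK : t + K ≠ 0) (n : ℕ) :
    t / (t + K) = ∑ i ∈ Finset.range n, (-1) ^ i * t ^ (i + 1) * (1 / K ^ (i + 1)) +
      (-1) ^ n / K ^ n * (t ^ (n + 1) / (t + K)) := by
  induction n with
  | zero => simp
  | succ n ih =>
    rw [ih, Finset.sum_range_succ, add_assoc]
    congr 1
    field_simp
    ring

theorem hasSum_one_div_succ_pow {l : ℕ} (hl : l ≠ 0) :
    HasSum (fun j : ℕ => 1 / ((j + 1 : ℕ) : ℝ) ^ (2 * l))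
      ((-1 : ℝ) ^ (l + 1) * (2 : ℝ) ^ (2 * l - 1) * Real.pi ^ (2 * l) *
        (_root_.bernoulli (2 * l) : ℚ) / (2 * l).factorial) := by
  -- The dropped term `k = 0` is `1 / 0 = 0`.
  have := (hasSum_nat_add_iff' 1).mpr (hasSum_zeta_nat hl)
  simpa [hl] using this

theorem hasSum_ratTerm (n : ℕ) (x : ℝ) :
    HasSum (fun j : ℕ => ratTerm n (j + 1) x) (psi1 x - polyPart n x) := by
  set t := (x / (2 * Real.pi)) ^ 2 with ht
  have h1 : HasSum (fun j : ℕ => ∑ i ∈ Finset.range n, 2 * ((-1) ^ i * t ^ (i + 1)) *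
      (1 / ((j + 1 : ℕ) : ℝ) ^ (2 * (i + 1))))
      (∑ i ∈ Finset.range n, x ^ (2 * (i + 1)) * ((_root_.bernoulli (2 * (i + 1)) : ℚ) : ℝ) /
        ((2 * (i + 1)).factorial : ℝ)) := by
    refine hasSum_sum fun i _ => ?_
    convert! (hasSum_one_div_succ_pow (Nat.succ_ne_zero i)).mul_left
      (2 * ((-1) ^ i * t ^ (i + 1))) using 1
    have h2 : (-1 : ℝ) ^ i * (-1) ^ (i + 1 + 1) = 1 := by
      rw [← pow_add, show i + (i + 1 + 1) = 2 * (i + 1) by ring, pow_mul]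
      norm_num
    have h3 : x ^ (2 * (i + 1)) = t ^ (i + 1) * (2 * 2 ^ (2 * (i + 1) - 1)) *
        Real.pi ^ (2 * (i + 1)) := by
      rw [← pow_succ', show 2 * (i + 1) - 1 + 1 = 2 * (i + 1) by omega, ht, ← pow_mul, mul_assoc,
        ← mul_pow, ← mul_pow]
      congr 1
      field_simp
    rw [h3]
    simp only [Nat.succ_eq_add_one]
    linear_combination -(2 * t ^ (i + 1) * 2 ^ (2 * (i + 1) - 1) * Real.pi ^ (2 * (i + 1)) *
        (_root_.bernoulli (2 * (i + 1)) : ℝ) / ((2 * (i + 1)).factorial : ℝ)) * h2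
  have h2 := (hasSum_psi1 x).sub h1
  rw [← ht] at h2
  convert! h2 using 1
  · ext j
    have hj : (0 : ℝ) < ((j + 1 : ℕ) : ℝ) := by positivity
    have ht0 : 0 ≤ t := sq_nonneg _
    rw [ratTerm_eq, ← ht, div_add_eq_sum (t := t) (K := ((j + 1 : ℕ) : ℝ) ^ 2) (by positivity)
      (by positivity) n, mul_add, Finset.mul_sum]
    simp only [← pow_mul, ← mul_assoc]
    ring
  · rw [polyPart]
    ring

theorem sum_Icc_one_eq_sum_range (f : ℕ → ℝ) (s : ℕ) :
    ∑ k ∈ Finset.Icc 1 s, f k = ∑ j ∈ Finset.range s, f (j + 1) := by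
  rw [Finset.range_eq_Ico, Finset.sum_Ico_add' f 0 s 1]
  rfl

theorem hasSum_errPart (n s : ℕ) (x : ℝ) :
    HasSum (fun j : ℕ => ratTerm n (j + s + 1) x) (errPart n s x) := by
  have := (hasSum_nat_add_iff' s).mpr (hasSum_ratTerm n x)
  rwa [← sum_Icc_one_eq_sum_range (fun k => ratTerm n k x), ← congrFun (ratPart_eq_sum n s) x]
    at this

/-- The tail of the Riemann zeta series. -/
theorem hasSum_zeta_tail (n s : ℕ) :
    HasSum (fun j : ℕ => 1 / ((j + s + 1 : ℕ) : ℝ) ^ (2 * n + 2))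
      ((riemannZeta (2 * (n : ℂ) + 2)).re -
        ∑ k ∈ Finset.Icc 1 s, 1 / (k : ℝ) ^ (2 * n + 2)) := by
  have hs : Summable fun k : ℕ => 1 / (k : ℝ) ^ (2 * n + 2) :=
    Real.summable_one_div_nat_pow.mpr (by omega)
  have hz : (riemannZeta (2 * (n : ℂ) + 2)).re = ∑' k : ℕ, 1 / (k : ℝ) ^ (2 * n + 2) := by
    have := zeta_nat_eq_tsum_of_gt_one (k := 2 * n + 2) (by omega)
    push_cast at this
    rw [this, ← Complex.ofReal_re (∑' k : ℕ, 1 / (k : ℝ) ^ (2 * n + 2)), Complex.ofReal_tsum]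
    push_cast
    rfl
  have h1 := (hasSum_nat_add_iff' 1).mpr hs.hasSum
  have h2 := (hasSum_nat_add_iff' s).mpr h1
  rw [← hz] at h2
  rw [sum_Icc_one_eq_sum_range]
  simpa using h2

/-- All terms of the tail have sign `(-1)^n`; dropping `t` from the denominators `t + k²` leaves the
zeta tail. -/
theorem neg_one_pow_mul_errPart_mem (n s : ℕ) (x : ℝ) : (-1) ^ n * errPart n s x ∈
    Set.Icc 0 (2 * ((x / (2 * Real.pi)) ^ 2) ^ (n + 1) * ((riemannZeta (2 * (n : ℂ) + 2)).re -
        ∑ k ∈ Finset.Icc 1 s, 1 / (k : ℝ) ^ (2 * n + 2))) := by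
  have h1 := (hasSum_errPart n s x).mul_left ((-1) ^ n)
  have habs : ∀ j : ℕ, (-1) ^ n * ratTerm n (j + s + 1) x = |ratTerm n (j + s + 1) x| := by
    intro j
    have : (-1 : ℝ) ^ n * (-1) ^ n = 1 := by rw [← mul_pow]; norm_num
    rw [abs_ratTerm, ratTerm_eq]
    linear_combination (2 / ((j + s + 1 : ℕ) : ℝ) ^ (2 * n) * (((x / (2 * Real.pi)) ^ 2) ^ (n + 1) /
      ((x / (2 * Real.pi)) ^ 2 + ((j + s + 1 : ℕ) : ℝ) ^ 2))) * this
  rw [funext habs] at h1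
  refine ⟨h1.nonneg fun j => abs_nonneg _, hasSum_le (fun j => ?_) h1
    ((hasSum_zeta_tail n s).mul_left _)⟩
  have hj : (0 : ℝ) < ((j + s + 1 : ℕ) : ℝ) := by positivity
  rw [abs_ratTerm]
  calc _ ≤ 2 / ((j + s + 1 : ℕ) : ℝ) ^ (2 * n) *
        (((x / (2 * Real.pi)) ^ 2) ^ (n + 1) / ((j + s + 1 : ℕ) : ℝ) ^ 2) := by
        gcongr
        linarith [sq_nonneg (x / (2 * Real.pi))]
    _ = _ := by
        rw [pow_add]
        field_simp
        ring

theorem abs_matFun_errPart_le (hA : A.IsHermitian) (n s : ℕ) {i j : Fin d} (hij : i ≠ j) :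
    |matFun (errPart n s) A i j| ≤ norm2 ((1 / (2 * Real.pi)) • A) ^ (2 * (n + 1)) *
      ((riemannZeta (2 * (n : ℂ) + 2)).re - ∑ k ∈ Finset.Icc 1 s, 1 / (k : ℝ) ^ (2 * n + 2)) := by
  -- Every matrix has half-bandwidth `d`; since the approximant is constant, only `i ≠ j` matters.
  have hm : HasHalfBandwidth A d := fun i j h => by unfold idxDist at h; omega
  set Z := (riemannZeta (2 * (n : ℂ) + 2)).re - ∑ k ∈ Finset.Icc 1 s, 1 / (k : ℝ) ^ (2 * n + 2)
    with hZ
  have hZ0 : 0 ≤ Z := (hasSum_zeta_tail n s).nonneg fun j => by positivity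
  set M := norm2 ((1 / (2 * Real.pi)) • A) ^ (2 * (n + 1)) * Z with hM
  refine hm.abs_matFun_le hA (C ((-1) ^ n * M)) ?_ fun x hx => ?_
  · rw [natDegree_C, mul_zero]
    unfold idxDist
    have : (i : ℕ) ≠ j := fun h => hij (Fin.ext h)
    omega
  · obtain ⟨h0, h1⟩ := neg_one_pow_mul_errPart_mem n s x
    rw [← hZ] at h1
    have h2 : 2 * ((x / (2 * Real.pi)) ^ 2) ^ (n + 1) * Z ≤ 2 * M := by
      rw [hM, mul_assoc, pow_mul]
      have := (sq_div_le_of_mem_spectrum hx).trans (pow_le_pow_left₀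
        (div_nonneg rho_nonneg (by positivity)) (rho_div_le_norm2 (A := A)) 2)
      gcongr
    rw [eval_C]
    have h3 : (-1 : ℝ) ^ n * (-1) ^ n = 1 := by rw [← mul_pow]; norm_num
    have h4 : errPart n s x - (-1) ^ n * M = (-1) ^ n * ((-1) ^ n * errPart n s x - M) := by
      linear_combination -errPart n s x * h3
    rw [h4, abs_mul, abs_pow, abs_neg, abs_one, one_pow, one_mul, abs_le]
    constructor <;> linarith

/-! ### The polynomial part and the splitting of `ψ₁(A)`. -/

theorem exists_natDegree_le_eval_eq_polyPart {n : ℕ} (hn : 1 ≤ n) :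
    ∃ P : ℝ[X], P.natDegree ≤ 2 * n ∧ ∀ x, P.eval x = polyPart n x := by
  refine ⟨C 1 - C (1 / 2) * X + ∑ i ∈ Finset.range n,
    C (((_root_.bernoulli (2 * (i + 1)) : ℚ) : ℝ) / ((2 * (i + 1)).factorial : ℝ)) * X ^ (2 * (i + 1)),
    ?_, fun x => ?_⟩
  · refine natDegree_add_le_of_degree_le ((natDegree_sub_le _ _).trans (max_le ?_ ?_)) ?_
    -- The linear term `-x/2` is where `1 ≤ n` enters: `p_0` has degree `1`, not `0`.
    · rw [natDegree_C]; omega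
    · exact (natDegree_C_mul_le _ _).trans (natDegree_X_le.trans (by omega))
    · refine natDegree_sum_le_of_forall_le _ _ fun i hi => (natDegree_C_mul_X_pow_le _ _).trans ?_
      have := Finset.mem_range.mp hi
      omega
  · rw [polyPart, eval_add, eval_sub, eval_mul, eval_C, eval_C, eval_X, eval_finsetSum]
    congr 1
    · ring
    · refine Finset.sum_congr rfl fun i _ => ?_
      rw [eval_mul, eval_C, eval_pow, eval_X]
      ring

theorem matFun_psi1_eq {m : ℕ} (hm : HasHalfBandwidth A m) (hA : A.IsHermitian) {n : ℕ}
    (hn : 1 ≤ n) (s : ℕ) {i j : Fin d} (hij : 2 * m * n < idxDist i j) :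
    matFun psi1 A i j = matFun (ratPart n s) A i j + matFun (errPart n s) A i j := by
  obtain ⟨P, hP, hPe⟩ := exists_natDegree_le_eval_eq_polyPart hn
  have h : psi1 = fun x => P.eval x + (ratPart n s x + errPart n s x) := by
    ext x
    rw [hPe, errPart]
    ring
  rw [h, matFun_add hA, matFun_add hA, matFun_eval hA, hm.aeval_apply_eq_zero P, zero_add]
  calc m * P.natDegree ≤ m * (2 * n) := Nat.mul_le_mul_left m hP
    _ = 2 * m * n := by ring
    _ < _ := hij

end PhiInverse

theorem theorem3 {d : ℕ} (A : Matrix (Fin d) (Fin d) ℝ) (hA : A.IsSymm)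
    (m : ℕ) (hm : PhiInverse.HasHalfBandwidth A m) (n s : ℕ) (i j : Fin d) :
    (1 ≤ n → 2 * m * n < PhiInverse.idxDist i j →
      |PhiInverse.matFun PhiInverse.psi1 A i j| ≤
        |PhiInverse.matFun (PhiInverse.ratPart n s) A i j| +
          |PhiInverse.matFun (PhiInverse.errPart n s) A i j|) ∧
    (|PhiInverse.matFun (PhiInverse.ratPart n s) A i j| ≤
      PhiInverse.norm2 ((1 / (2 * Real.pi)) • A) ^ (2 * (n + 1)) *
        ∑ ν : Fin d with PhiInverse.idxDist ν j ≤ 2 * m * (n + 1),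
          ∑ k ∈ Finset.Icc 1 s,
            PhiInverse.cCoef A k / (k : ℝ) ^ (2 * n) *
              PhiInverse.lam A m k ^ PhiInverse.idxDist i ν) ∧
    (i ≠ j →
      |PhiInverse.matFun (PhiInverse.errPart n s) A i j| ≤
        PhiInverse.norm2 ((1 / (2 * Real.pi)) • A) ^ (2 * (n + 1)) *
          ((riemannZeta (2 * (n : ℂ) + 2)).re -
            ∑ k ∈ Finset.Icc 1 s, 1 / (k : ℝ) ^ (2 * n + 2))) := by
  have hH : A.IsHermitian := by
    rw [Matrix.IsHermitian, Matrix.conjTranspose_eq_transpose_of_trivial]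
    exact hA
  refine ⟨fun hn hij => ?_, PhiInverse.abs_matFun_ratPart_le hm hH n s i j,
    fun hij => PhiInverse.abs_matFun_errPart_le hH n s hij⟩
  rw [PhiInverse.matFun_psi1_eq hm hH hn s hij]
  exact abs_add_le _ _
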